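/- Let $K$ be a field and $S=K[x_1,\ldots,x_n]$. A monomial ideal $J\subseteq S$ is called squarefree Borel if it is generated by squarefree monomials and, for every squarefree monomial $w\in J$, every $j$ with $x_j\mid w$ and every $i<j$, one has $x_i(w/x_j)\in J$ whenever $x_i(w/x_j)$ is squarefree. Let $u\neq 1$ be a squarefree monomial and let $I$ be the squarefree principal Borel ideal with Borel generator $u$, that is, the smallest squarefree Borel ideal containing $u$ (the intersection of all of them). A block of $u$ is a nonempty set of consecutive integers contained in $\operatorname{supp}(u)=\{i : x_i\mid u\}$; let $B_1$ be the first block of $u$, i.e. the maximal block (with respect to inclusion) that precedes all other maximal blocks. Let $h=\operatorname{height}(I)$, and for $A\subseteq\{1,\ldots,n\}$ put $P_A=(x_i : i\in A)$. Then an ideal $P$ of $S$ is a minimal prime ideal of $I$ of height $h$ if and only if $P=P_A$ for some $A\subseteq\{1,\ldots,\max(B_1)\}$ with $|A|=h$. Moreover, the multiplicity of $S/I$ is $$e(S/I)=\binom{\max(B_1)}{|B_1|-1}.$$ Here $e(S/I)=Q(1)$, where $Q(t)\in\mathbb Z[t]$ is the polynomial with $\sum_{i\ge 0}\dim_K (S/I)_i\,t^i=Q(t)/(1-t)^d$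 and $d=\dim S/I$. -/

import Mathlib

/-! Throughout, `S = K[x₁, …, xₙ]` is `MvPolynomial (Fin n) K`; the element `i : Fin n` stands for
the (one-based) index `i + 1`, so that `X i` is the variable `x_{i+1}`. A monomial is represented by
its exponent vector `a : Fin n →₀ ℕ`, and its support is `a.support`. -/

namespace SqfreeBorel

open MvPolynomial

/-- The monomial with exponent vector `a` is `k`-bounded: all its exponents are at most `k`.
For `k = 1` these are the squarefree monomials. -/
def IsBounded {n : ℕ} (k : ℕ) (a : Fin n →₀ ℕ) : Prop :=
  ∀ i, a i ≤ k

/-- The exponent vector of `x_i (u / x_j)`, where `u` has exponent vector `a`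
(used only when `x_j` divides `u`). -/
noncomputable def exchange {n : ℕ} (a : Fin n →₀ ℕ) (j i : Fin n) : Fin n →₀ ℕ :=
  a - Finsupp.single j 1 + Finsupp.single i 1

/-- `k`-Borel ideals: ideals generated by `k`-bounded monomials such that, for every `k`-bounded
monomial `u ∈ I`, every `j ∈ supp u` and every `i < j`, one has `x_i (u / x_j) ∈ I` as soon as
this monomial is again `k`-bounded. The squarefree Borel ideals are the `1`-Borel ideals. -/
structure IsKBorel {n : ℕ} {K : Type*} [Field K] (k : ℕ)
    (I : Ideal (MvPolynomial (Fin n) K)) : Prop where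
  generated : ∃ G : Set (Fin n →₀ ℕ), (∀ a ∈ G, IsBounded k a) ∧
    I = Ideal.span ((fun a => monomial a (1 : K)) '' G)
  exchange_mem : ∀ a : Fin n →₀ ℕ, IsBounded k a → monomial a (1 : K) ∈ I →
    ∀ j ∈ a.support, ∀ i, i < j → IsBounded k (exchange a j i) →
      monomial (exchange a j i) (1 : K) ∈ I

/-- The smallest `k`-Borel ideal containing the monomials with exponent vectors in `U`:
the intersection of all `k`-Borel ideals containing them. -/
noncomputable def borelIdeal {n : ℕ} (K : Type*) [Field K] (k : ℕ) (U : Set (Fin n →₀ ℕ)) :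
    Ideal (MvPolynomial (Fin n) K) :=
  sInf {J | IsKBorel k J ∧ ∀ a ∈ U, monomial a (1 : K) ∈ J}

/-- `I` is the squarefree principal Borel ideal with Borel generator the squarefree monomial with
exponent vector `u`. -/
def IsSqfreePrincipalBorel {n : ℕ} {K : Type*} [Field K]
    (I : Ideal (MvPolynomial (Fin n) K)) (u : Fin n →₀ ℕ) : Prop :=
  IsBounded 1 u ∧ I = borelIdeal K 1 {u}

/-- A block of `u`: a nonempty set of consecutive indices contained in the support of `u`. -/
def IsBlock {n : ℕ} (u : Fin n →₀ ℕ) (B : Finset (Fin n)) : Prop :=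
  B ⊆ u.support ∧ ∃ a b : Fin n, a ≤ b ∧ B = Finset.Icc a b

/-- The first block of `u`: the maximal block all of whose elements are smaller than the elements
of every other maximal block. -/
def IsFirstBlock {n : ℕ} (u : Fin n →₀ ℕ) (B : Finset (Fin n)) : Prop :=
  Maximal (IsBlock u) B ∧
    ∀ C, Maximal (IsBlock u) C → C ≠ B → ∀ b ∈ B, ∀ c ∈ C, b < c

/-- The largest element of `B`, in one-based indexing. -/
def maxIndex {n : ℕ} (B : Finset (Fin n)) : ℕ :=
  B.sup fun i => (i : ℕ) + 1

/-- The ideal `P_A = (x_i : i ∈ A)`. -/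
noncomputable def varIdeal {n : ℕ} (K : Type*) [Field K] (A : Finset (Fin n)) :
    Ideal (MvPolynomial (Fin n) K) :=
  Ideal.span ((fun i => (X i : MvPolynomial (Fin n) K)) '' (A : Set (Fin n)))

/-- The Hilbert function of `S/I` (for a homogeneous ideal `I`): the `K`-dimension of the degree `i`
component of `S/I`, that is, of the image of the space of forms of degree `i`. -/
noncomputable def hilbertFunction {n : ℕ} {K : Type*} [Field K]
    (I : Ideal (MvPolynomial (Fin n) K)) (i : ℕ) : ℕ :=
  Module.finrank K
    ((homogeneousSubmodule (Fin n) K i).map (Ideal.Quotient.mkₐ K I).toLinearMap)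

/-- The Hilbert series `∑ᵢ dim_K (S/I)ᵢ tⁱ` of `S/I`. -/
noncomputable def hilbertSeries {n : ℕ} {K : Type*} [Field K]
    (I : Ideal (MvPolynomial (Fin n) K)) : PowerSeries ℤ :=
  PowerSeries.mk fun i => (hilbertFunction I i : ℤ)

/-- `e` is the multiplicity of the standard graded algebra `S/I`: with `d = dim S/I` the Krull
dimension, the Hilbert series of `S/I` is `Q(t)/(1 - t)^d` for a polynomial `Q` with integer
coefficients, and `e = Q(1)`. -/
def HasMultiplicity {n : ℕ} {K : Type*} [Field K]
    (I : Ideal (MvPolynomial (Fin n) K)) (e : ℤ) : Prop :=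
  ∃ (d : ℕ) (Q : Polynomial ℤ),
    ringKrullDim (MvPolynomial (Fin n) K ⧸ I) = (d : WithBot ℕ∞) ∧
    hilbertSeries I * (1 - PowerSeries.X) ^ d = (Q : PowerSeries ℤ) ∧
    Q.eval 1 = e

/-- The multiplicity is unique. -/
theorem HasMultiplicity.unique {n : ℕ} {K : Type*} [Field K]
    {I : Ideal (MvPolynomial (Fin n) K)} {e e' : ℤ}
    (h : HasMultiplicity I e) (h' : HasMultiplicity I e') : e = e' := by
  obtain ⟨d, Q, hd, hQ, rfl⟩ := h
  obtain ⟨d', Q', hd', hQ', rfl⟩ := h'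
  have hdd : d = d' := by
    rw [hd] at hd'
    exact_mod_cast hd'
  subst hdd
  rw [hQ] at hQ'
  rw [Polynomial.coe_injective ℤ hQ']

end SqfreeBorel

namespace SqfreeBorel

open MvPolynomial

/-! Write G = supp(u). Borel moves only push indices down, so I is spanned by the monomials whose
support dominates G (`mem_dominanceIdeal`, `borelIdeal_singleton`). Hence I ⊆ P_A exactly when the
complement of A does not dominate G, that is, when some initial segment contains more elements of A
than of Gᶜ.

Let the first block be [a, b], zero-based. The initial segment of length k contains exactly a
elements of Gᶜ for a ≤ k ≤ b + 1, and at least a + 1 for larger k as soon as b + 1 is an index. So I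
⊆ P_A forces |A| ≥ a + 1, and when |A| = a + 1 it holds iff A ⊆ [0, b]
(`StartsWith.not_dominates_compl_iff`). Every prime over I contains such a P_A, so the height is a +
1 and the minimal primes of that height are as claimed.

I is the Stanley–Reisner ideal of the complex of sets not dominating G. The multiplicity counts its
faces of maximal size; their complements are the (a + 1)-subsets of [0, b], and C(b + 1, a + 1) =
C(b + 1, b - a) with |B₁| = b - a + 1. -/

/-- `F` dominates `G` when every initial segment meets `F` in at least as many elements as `G`. -/
def Dominates {n : ℕ} (G F : Finset (Fin n)) : Prop :=
  ∀ k : ℕ, (G.filter fun i : Fin n => (i : ℕ) < k).card ≤ (F.filter fun i : Fin n => (i : ℕ) < k).card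

/-! ### Dominance order on finite sets of indices -/

section Combinatorics

variable {n : ℕ} {F G H : Finset (Fin n)}

theorem Dominates.refl (G : Finset (Fin n)) : Dominates G G := fun _ => le_rfl

theorem Dominates.trans (h : Dominates G F) (h' : Dominates F H) : Dominates G H :=
  fun k => (h k).trans (h' k)

theorem Dominates.of_subset (h : G ⊆ F) : Dominates G F :=
  fun _ => Finset.card_le_card (Finset.filter_subset_filter _ h)

/-- Replacing an element by a smaller one that is not yet present moves up in the dominance
order. -/
theorem dominates_insert_erase {i j : Fin n} (hij : i < j) (hi : i ∉ F) :
    Dominates F (insert i (F.erase j)) := by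
  intro k
  rw [Finset.filter_insert, Finset.filter_erase]
  by_cases hik : (i : ℕ) < k
  · rw [if_pos hik, Finset.card_insert_of_notMem (by simp [hi])]
    have := Finset.pred_card_le_card_erase (s := F.filter fun i : Fin n => (i : ℕ) < k) (a := j)
    omega
  · rw [if_neg hik, Finset.erase_eq_of_notMem]
    simp only [Finset.mem_filter, not_and]
    intro _
    have : (i : ℕ) < j := hij
    omega

/-- If `F` dominates `G` and does not contain it, then some exchange on `G` gives a set that is
still dominated by `F` and is closer to being contained in `F`. -/
theorem Dominates.exists_exchange (h : Dominates G F) (hGF : ¬ G ⊆ F) :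
    ∃ j ∈ G, ∃ i, i < j ∧ i ∉ G ∧ Dominates (insert i (G.erase j)) F ∧
      (insert i (G.erase j) \ F).card < (G \ F).card := by
  have hne : (G \ F).Nonempty := Finset.sdiff_nonempty.mpr hGF
  obtain ⟨hjG, hjF⟩ := Finset.mem_sdiff.mp ((G \ F).min'_mem hne)
  set j := (G \ F).min' hne with hj
  have hmin : ∀ x ∈ G, x < j → x ∈ F := fun x hx hxj => by
    by_contra hxF
    exact absurd ((G \ F).min'_le x (Finset.mem_sdiff.mpr ⟨hx, hxF⟩)) (not_le.mpr hxj)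
  -- If F had nothing new below j, then up to j it would be a proper subset of G, which misses j;
  -- this contradicts dominance at k = j + 1.
  have hex : ∃ i, i < j ∧ i ∈ F ∧ i ∉ G := by
    by_contra! hcon
    have hk := h (j + 1)
    have hss : (F.filter fun i : Fin n => (i : ℕ) < j + 1) ⊂ G.filter fun i : Fin n => (i : ℕ) < j + 1 := by
      rw [Finset.ssubset_iff_of_subset]
      · exact ⟨j, by simp [hjG], by simp [hjF]⟩
      · intro x hx
        rw [Finset.mem_filter] at hx ⊢
        refine ⟨?_, hx.2⟩
        have hxj : x ≤ j := Fin.le_def.mpr (by omega)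
        rcases hxj.eq_or_lt with e | e
        · exact absurd (e ▸ hx.1) hjF
        · exact hcon x e hx.1
    exact absurd (Finset.card_lt_card hss) (not_lt.mpr hk)
  obtain ⟨i, hij, hiF, hiG⟩ := hex
  refine ⟨j, hjG, i, hij, hiG, ?_, ?_⟩
  · intro k
    have hij' : (i : ℕ) < j := hij
    -- Past j the exchange leaves the count unchanged. Up to j the exchanged set lies inside F, by
    -- minimality of j.
    by_cases hkj : (j : ℕ) < k
    · refine le_trans (le_of_eq ?_) (h k)
      rw [Finset.filter_insert, Finset.filter_erase, if_pos (hij'.trans hkj),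
        Finset.card_insert_of_notMem (by simp [hiG])]
      exact Finset.card_erase_add_one (by simp [hjG, hkj])
    · refine Finset.card_le_card fun x hx => ?_
      simp only [Finset.mem_filter, Finset.mem_insert, Finset.mem_erase] at hx ⊢
      refine ⟨?_, hx.2⟩
      rcases hx.1 with rfl | hx'
      · exact hiF
      · exact hmin x hx'.2 (Fin.lt_def.mpr (by omega))
  · refine Finset.card_lt_card ?_
    rw [Finset.ssubset_iff_of_subset]
    · exact ⟨j, by simp [hjG, hjF], by simp [hij.ne']⟩
    · intro x hx
      simp only [Finset.mem_sdiff, Finset.mem_insert, Finset.mem_erase] at hx ⊢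
      rcases hx with ⟨rfl | hx, hxF⟩
      · exact absurd hiF hxF
      · exact ⟨hx.2, hxF⟩

theorem card_filter_lt_add_card_filter_compl (F : Finset (Fin n)) (k : ℕ) :
    (F.filter fun i : Fin n => (i : ℕ) < k).card + (Fᶜ.filter fun i : Fin n => (i : ℕ) < k).card =
      ((Finset.univ : Finset (Fin n)).filter fun i : Fin n => (i : ℕ) < k).card := by
  rw [← Finset.card_union_of_disjoint, ← Finset.filter_union, Finset.union_compl]
  exact Finset.disjoint_filter_filter disjoint_compl_right

theorem not_dominates_iff :
    ¬ Dominates G F ↔ ∃ k : ℕ, (Gᶜ.filter fun i : Fin n => (i : ℕ) < k).card <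
      (Fᶜ.filter fun i : Fin n => (i : ℕ) < k).card := by
  simp only [Dominates, not_forall, not_le]
  refine exists_congr fun k => ?_
  have h₁ := card_filter_lt_add_card_filter_compl F k
  have h₂ := card_filter_lt_add_card_filter_compl G k
  omega

/-- The data that a first block provides: `G` has no elements below `a`, contains `[a, b]`, and
does not contain the successor of `b`. -/
structure StartsWith (G : Finset (Fin n)) (a b : Fin n) : Prop where
  le : a ≤ b
  Icc_subset : Finset.Icc a b ⊆ G
  notMem_of_lt : ∀ i, i < a → i ∉ G
  notMem_succ : ∀ i : Fin n, (i : ℕ) = b + 1 → i ∉ G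

variable {a b : Fin n}

theorem StartsWith.Iio_subset (hG : StartsWith G a b) : Finset.Iio a ⊆ Gᶜ := fun i hi =>
  Finset.mem_compl.mpr (hG.notMem_of_lt i (Finset.mem_Iio.mp hi))

theorem StartsWith.le_card_filter_compl (hG : StartsWith G a b) {k : ℕ} (hk : (a : ℕ) ≤ k) :
    (a : ℕ) ≤ (Gᶜ.filter fun i : Fin n => (i : ℕ) < k).card := by
  rw [← Fin.card_Iio a]
  refine Finset.card_le_card fun i hi => Finset.mem_filter.mpr ⟨hG.Iio_subset hi, ?_⟩
  have : (i : ℕ) < a := Fin.lt_def.mp (Finset.mem_Iio.mp hi)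
  omega

theorem StartsWith.le_of_card_filter_lt (hG : StartsWith G a b) {A : Finset (Fin n)} {k : ℕ}
    (hk : (Gᶜ.filter fun i : Fin n => (i : ℕ) < k).card <
      (A.filter fun i : Fin n => (i : ℕ) < k).card) : (a : ℕ) ≤ k := by
  by_contra! hka
  refine absurd (Finset.card_le_card fun i hi => ?_) (not_le.mpr hk)
  have hik : (i : ℕ) < k := (Finset.mem_filter.mp hi).2
  exact Finset.mem_filter.mpr
    ⟨hG.Iio_subset (Finset.mem_Iio.mpr (Fin.lt_def.mpr (hik.trans hka))), hik⟩

theorem StartsWith.lt_card_compl (hG : StartsWith G a b) (hF : ¬ Dominates G F) :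
    (a : ℕ) < Fᶜ.card := by
  obtain ⟨k, hk⟩ := not_dominates_iff.mp hF
  exact ((hG.le_card_filter_compl (hG.le_of_card_filter_lt hk)).trans_lt hk).trans_le
    (Finset.card_filter_le _ _)

/-- The witnessing segment must contain all a + 1 elements of A and only a elements of Gᶜ. A longer
segment than [0, b] would also contain the gap b + 1. -/
theorem StartsWith.not_dominates_compl_iff (hG : StartsWith G a b) {A : Finset (Fin n)}
    (hA : A.card = a + 1) : ¬ Dominates G Aᶜ ↔ ∀ i ∈ A, i ≤ b := by
  rw [not_dominates_iff, compl_compl]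
  constructor
  · rintro ⟨k, hk⟩ i hi
    have hak := hG.le_of_card_filter_lt hk
    have hle := hG.le_card_filter_compl hak
    by_contra! hbi
    have hbi' : (b : ℕ) < i := hbi
    rcases le_or_gt k (b + 1) with hkb | hkb
    · have hsub : (A.filter fun i : Fin n => (i : ℕ) < k) ⊆ A.erase i := fun x hx => by
        obtain ⟨hxA, hxk⟩ := Finset.mem_filter.mp hx
        refine Finset.mem_erase.mpr ⟨?_, hxA⟩
        rintro rfl
        omega
      have := Finset.card_le_card hsub
      rw [Finset.card_erase_of_mem hi] at this
      omega
    · have hab : (a : ℕ) ≤ b := hG.le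
      have hsub : insert (⟨b + 1, by omega⟩ : Fin n) (Finset.Iio a) ⊆
          Gᶜ.filter fun i : Fin n => (i : ℕ) < k := by
        intro x hx
        rcases Finset.mem_insert.mp hx with rfl | hx
        · simpa [hkb] using hG.notMem_succ ⟨b + 1, by omega⟩ rfl
        · have : (x : ℕ) < a := Fin.lt_def.mp (Finset.mem_Iio.mp hx)
          exact Finset.mem_filter.mpr ⟨hG.Iio_subset hx, by omega⟩
      have h₁ := Finset.card_le_card hsub
      have hnot : (⟨b + 1, by omega⟩ : Fin n) ∉ Finset.Iio a := by
        rw [Finset.mem_Iio, Fin.lt_def]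
        simp only
        omega
      rw [Finset.card_insert_of_notMem hnot, Fin.card_Iio] at h₁
      have h₂ := Finset.card_filter_le A fun i : Fin n => (i : ℕ) < k
      omega
  · intro h
    -- The segment [0, b] contains all of A, while its only elements of Gᶜ are the a indices below
    -- the block.
    refine ⟨b + 1, ?_⟩
    rw [Finset.filter_true_of_mem (s := A) fun i hi => by
      have : (i : ℕ) ≤ b := h i hi
      omega, hA, Nat.lt_succ_iff, ← Fin.card_Iio a]
    refine Finset.card_le_card fun i hi => ?_
    obtain ⟨hiG, hib⟩ := Finset.mem_filter.mp hi
    by_contra hia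
    rw [Finset.mem_Iio, not_lt] at hia
    exact Finset.mem_compl.mp hiG (hG.Icc_subset
      (Finset.mem_Icc.mpr ⟨hia, Fin.le_def.mpr (by omega)⟩))

end Combinatorics

/-- A support element below a would lie in another maximal block, which B should precede; one at b +
1 would enlarge B. -/
theorem IsFirstBlock.exists_startsWith {n : ℕ} {u : Fin n →₀ ℕ} {B : Finset (Fin n)}
    (hB : IsFirstBlock u B) :
    ∃ a b : Fin n, B = Finset.Icc a b ∧ StartsWith u.support a b := by
  obtain ⟨hmax, hfirst⟩ := hB
  obtain ⟨hBu, a, b, hab, rfl⟩ := hmax.prop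
  refine ⟨a, b, rfl, hab, hBu, fun c hca hc => ?_, fun c hcb hc => ?_⟩
  · have hblock : IsBlock u {c} := ⟨by simpa using hc, c, c, le_rfl, by simp⟩
    obtain ⟨C, hcC, hC⟩ := (Set.toFinite {C | IsBlock u C}).exists_le_maximal hblock
    have hc' : c ∈ C := hcC (Finset.mem_singleton_self c)
    by_cases hCB : C = Finset.Icc a b
    · rw [hCB, Finset.mem_Icc] at hc'
      exact absurd hc'.1 (not_le.mpr hca)
    · exact absurd (hfirst C hC hCB a (by simp [hab]) c hc') (not_lt.mpr hca.le)
  · have hbc : b ≤ c := Fin.le_def.mpr (by omega)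
    have hblock : IsBlock u (Finset.Icc a c) := by
      refine ⟨fun i hi => ?_, a, c, hab.trans hbc, rfl⟩
      obtain ⟨h₁, h₂⟩ := Finset.mem_Icc.mp hi
      rcases h₂.eq_or_lt with rfl | h₂
      · exact hc
      · exact hBu (Finset.mem_Icc.mpr ⟨h₁, Fin.le_def.mpr (by have : (i : ℕ) < c := h₂; omega)⟩)
    have := hmax.le_of_ge hblock (Finset.Icc_subset_Icc_right hbc)
      (Finset.mem_Icc.mpr ⟨hab.trans hbc, le_rfl⟩)
    have : (c : ℕ) ≤ b := (Finset.mem_Icc.mp this).2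
    omega

/-! ### The principal Borel ideal as a dominance ideal -/

section BorelIdeal

variable {n : ℕ} {K : Type*} [Field K]

theorem support_exchange {a : Fin n →₀ ℕ} {i j : Fin n} (ha : IsBounded 1 a)
    (hij : i ≠ j) : (exchange a j i).support = insert i (a.support.erase j) := by
  ext x
  have hx := ha x
  have hj := ha j
  simp only [exchange, Finsupp.mem_support_iff, Finsupp.add_apply, Finsupp.tsub_apply,
    Finsupp.single_apply, Finset.mem_insert, Finset.mem_erase]
  grind

theorem IsBounded.notMem_support_of_exchange {a : Fin n →₀ ℕ} {i j : Fin n} (hij : i ≠ j)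
    (h : IsBounded 1 (exchange a j i)) : i ∉ a.support := by
  have := h i
  simp only [exchange, Finsupp.add_apply, Finsupp.tsub_apply, Finsupp.single_eq_same,
    Finsupp.single_eq_of_ne hij] at this
  rw [Finsupp.notMem_support_iff]
  omega

theorem isBounded_exchange {a : Fin n →₀ ℕ} {i j : Fin n} (ha : IsBounded 1 a)
    (hi : i ∉ a.support) : IsBounded 1 (exchange a j i) := by
  intro x
  have hx := ha x
  rw [Finsupp.notMem_support_iff] at hi
  simp only [exchange, Finsupp.add_apply, Finsupp.tsub_apply, Finsupp.single_apply]
  grind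

theorem IsBounded.le_of_support_subset {a c : Fin n →₀ ℕ} (ha : IsBounded 1 a)
    (h : a.support ⊆ c.support) : a ≤ c := by
  intro x
  by_cases hx : x ∈ a.support
  · have := Finsupp.mem_support_iff.mp (h hx)
    have := ha x
    omega
  · rw [Finsupp.notMem_support_iff.mp hx]
    exact Nat.zero_le _

theorem support_indicator_one (A : Finset (Fin n)) :
    (Finsupp.indicator A fun _ _ => 1 : Fin n →₀ ℕ).support = A := by
  ext i
  simp [Finsupp.indicator_apply]

theorem support_monomial_one (a : Fin n →₀ ℕ) : (monomial a (1 : K)).support = {a} := by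
  classical
  rw [support_monomial, if_neg one_ne_zero]

theorem monomial_mem_of_le {I : Ideal (MvPolynomial (Fin n) K)} {a c : Fin n →₀ ℕ} (h : a ≤ c)
    (ha : monomial a (1 : K) ∈ I) : monomial c (1 : K) ∈ I :=
  I.mem_of_dvd (monomial_dvd_monomial.mpr ⟨Or.inr h, dvd_rfl⟩) ha

/-- The ideal spanned by the squarefree monomials whose support dominates `G`. -/
noncomputable def dominanceIdeal (K : Type*) [Field K] (G : Finset (Fin n)) :
    Ideal (MvPolynomial (Fin n) K) :=
  Ideal.span ((fun a => monomial a (1 : K)) '' {a | IsBounded 1 a ∧ Dominates G a.support})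

theorem mem_dominanceIdeal {G : Finset (Fin n)} {p : MvPolynomial (Fin n) K} :
    p ∈ dominanceIdeal K G ↔ ∀ a ∈ p.support, Dominates G a.support := by
  rw [dominanceIdeal, mem_ideal_span_monomial_image]
  refine forall₂_congr fun a _ => ⟨?_, fun h => ?_⟩
  · rintro ⟨c, ⟨-, hc⟩, hca⟩
    exact hc.trans (Dominates.of_subset (Finsupp.support_mono hca))
  · refine ⟨Finsupp.indicator a.support fun _ _ => 1, ⟨fun i => ?_, ?_⟩, fun i => ?_⟩
    · rw [Finsupp.indicator_apply]
      split_ifs <;> simp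
    · rwa [support_indicator_one]
    · rw [Finsupp.indicator_apply]
      split_ifs with hi
      · exact Nat.one_le_iff_ne_zero.mpr (Finsupp.mem_support_iff.mp hi)
      · exact Nat.zero_le _

theorem monomial_mem_dominanceIdeal {G : Finset (Fin n)} {a : Fin n →₀ ℕ} :
    monomial a (1 : K) ∈ dominanceIdeal K G ↔ Dominates G a.support := by
  rw [mem_dominanceIdeal, support_monomial_one]
  simp

theorem isKBorel_dominanceIdeal (G : Finset (Fin n)) : IsKBorel 1 (dominanceIdeal K G) where
  generated := ⟨_, fun _ ha => ha.1, rfl⟩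
  exchange_mem a ha haI j hj i hij hb := by
    rw [monomial_mem_dominanceIdeal] at haI ⊢
    rw [support_exchange ha hij.ne]
    exact haI.trans (dominates_insert_erase hij (hb.notMem_support_of_exchange hij.ne))

/-- Borel exchanges shrink supp(a) \ supp(c) until it is empty; then the monomial reached divides
the one with exponent c. -/
theorem IsKBorel.monomial_mem_of_dominates {J : Ideal (MvPolynomial (Fin n) K)}
    (hJ : IsKBorel 1 J) {a c : Fin n →₀ ℕ} (ha : IsBounded 1 a) (haJ : monomial a (1 : K) ∈ J)
    (hac : Dominates a.support c.support) : monomial c (1 : K) ∈ J := by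
  induction hd : (a.support \ c.support).card using Nat.strong_induction_on generalizing a with
  | _ d ih =>
    by_cases hsub : a.support ⊆ c.support
    · exact monomial_mem_of_le (ha.le_of_support_subset hsub) haJ
    · obtain ⟨j, hj, i, hij, hi, hdom, hlt⟩ := hac.exists_exchange hsub
      have hb := isBounded_exchange (j := j) ha hi
      rw [← support_exchange ha hij.ne] at hdom hlt
      exact ih _ (hd ▸ hlt) hb (hJ.exchange_mem a ha haJ j hj i hij hb) hdom rfl

theorem borelIdeal_singleton {u : Fin n →₀ ℕ} (hu : IsBounded 1 u) :
    borelIdeal K 1 {u} = dominanceIdeal K u.support := by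
  apply le_antisymm
  · refine sInf_le ⟨isKBorel_dominanceIdeal _, ?_⟩
    rintro a rfl
    exact monomial_mem_dominanceIdeal.mpr (Dominates.refl _)
  · refine le_sInf ?_
    rintro J ⟨hJ, huJ⟩
    refine Ideal.span_le.mpr ?_
    rintro _ ⟨c, ⟨-, hc⟩, rfl⟩
    exact hJ.monomial_mem_of_dominates hu (huJ u rfl) hc

end BorelIdeal

/-! ### Primes generated by variables, height and minimal primes -/

section VarIdeal

variable {n : ℕ} {K : Type*} [Field K]

theorem mem_varIdeal {A : Finset (Fin n)} {p : MvPolynomial (Fin n) K} :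
    p ∈ varIdeal K A ↔ ∀ a ∈ p.support, ∃ i ∈ A, a i ≠ 0 := by
  rw [varIdeal, mem_ideal_span_X_image]
  simp only [Finset.mem_coe]

theorem X_mem_varIdeal {A : Finset (Fin n)} {i : Fin n} :
    (X i : MvPolynomial (Fin n) K) ∈ varIdeal K A ↔ i ∈ A := by
  rw [mem_varIdeal, support_X]
  simp [Finsupp.single_apply]

theorem varIdeal_injective : Function.Injective (varIdeal K : Finset (Fin n) → _) := by
  intro A B h
  ext i
  rw [← X_mem_varIdeal (K := K), h, X_mem_varIdeal]

theorem varIdeal_mono {A B : Finset (Fin n)} (h : A ⊆ B) : varIdeal K A ≤ varIdeal K B :=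
  Ideal.span_mono (Set.image_mono (Finset.coe_subset.mpr h))

/-- The ideal `P_A` is the kernel of the substitution killing the variables in `A`. -/
theorem varIdeal_eq_ker (A : Finset (Fin n)) :
    varIdeal K A = RingHom.ker
      (aeval (fun i => if i ∈ A then 0 else X i) :
        MvPolynomial (Fin n) K →ₐ[K] MvPolynomial (Fin n) K) := by
  set φ : MvPolynomial (Fin n) K →ₐ[K] MvPolynomial (Fin n) K :=
    aeval (fun i => if i ∈ A then 0 else X i) with hφ
  apply le_antisymm
  · refine Ideal.span_le.mpr ?_
    rintro _ ⟨i, hi, rfl⟩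
    have : i ∈ A := hi
    simp [hφ, RingHom.mem_ker, this]
  · intro p hp
    -- The substitution is the identity modulo P_A, so its kernel lies in P_A.
    have key : (Ideal.Quotient.mkₐ K (varIdeal K A)).comp φ =
        Ideal.Quotient.mkₐ K (varIdeal K A) := by
      refine algHom_ext fun i => ?_
      by_cases hi : i ∈ A
      · simpa [hφ, hi] using
          (Ideal.Quotient.eq_zero_iff_mem.mpr (X_mem_varIdeal (K := K).mpr hi)).symm
      · simp [hφ, hi]
    have := DFunLike.congr_fun key p
    rw [AlgHom.comp_apply, (RingHom.mem_ker).mp hp, map_zero] at this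
    exact Ideal.Quotient.eq_zero_iff_mem.mp this.symm

instance isPrime_varIdeal (A : Finset (Fin n)) : (varIdeal K A).IsPrime := by
  rw [varIdeal_eq_ker]
  exact RingHom.ker_isPrime _

/-- Krull's height theorem bounds it above; adding one variable at a time gives a strict chain of
primes. -/
theorem height_varIdeal (A : Finset (Fin n)) : (varIdeal K A).height = A.card := by
  classical
  apply le_antisymm
  · have hmem : varIdeal K A ∈ (Ideal.span
        ((A.image fun i => (X i : MvPolynomial (Fin n) K) : Finset _) :
          Set (MvPolynomial (Fin n) K))).minimalPrimes := by
      rw [Finset.coe_image]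
      exact Ideal.minimalPrimes_eq_subsingleton_self (I := varIdeal K A) ▸ rfl
    refine (Ideal.height_le_card_of_mem_minimalPrimes_span_finset hmem).trans ?_
    exact_mod_cast Finset.card_image_le
  · induction A using Finset.induction_on with
    | empty => simp
    | insert i A hi ih =>
      rw [Finset.card_insert_of_notMem hi]
      have hlt : varIdeal K A < varIdeal K (insert i A) := by
        refine (varIdeal_mono (Finset.subset_insert i A)).lt_of_ne fun h => hi ?_
        rw [varIdeal_injective h]
        exact Finset.mem_insert_self i A
      push_cast
      exact (add_le_add_left ih 1).trans (Ideal.height_add_one_le_of_lt_of_isPrime hlt)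

/-- The test monomial is the product of the variables outside A: a monomial avoids P_A iff its
support lies in Aᶜ. -/
theorem dominanceIdeal_le_varIdeal_iff {G A : Finset (Fin n)} :
    dominanceIdeal K G ≤ varIdeal K A ↔ ¬ Dominates G Aᶜ := by
  constructor
  · intro h hdom
    have hmem : monomial (Finsupp.indicator Aᶜ fun _ _ => 1) (1 : K) ∈ dominanceIdeal K G := by
      rw [monomial_mem_dominanceIdeal, support_indicator_one]
      exact hdom
    have := mem_varIdeal.mp (h hmem)
    rw [support_monomial_one] at this
    obtain ⟨i, hi, hi'⟩ := this _ (Finset.mem_singleton_self _)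
    simp [Finsupp.indicator_apply, hi] at hi'
  · intro h p hp
    rw [mem_varIdeal]
    intro a ha
    by_contra! hcon
    refine h ((mem_dominanceIdeal.mp hp a ha).trans (Dominates.of_subset fun i hi => ?_))
    exact Finset.mem_compl.mpr fun hiA => Finsupp.mem_support_iff.mp hi (hcon i hiA)

/-- Every prime ideal containing a dominance ideal contains some `P_A` that contains it. -/
theorem exists_varIdeal_le {G : Finset (Fin n)} {P : Ideal (MvPolynomial (Fin n) K)} [P.IsPrime]
    (h : dominanceIdeal K G ≤ P) :
    ∃ A : Finset (Fin n), dominanceIdeal K G ≤ varIdeal K A ∧ varIdeal K A ≤ P := by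
  classical
  -- Since P is prime, each generating monomial in P has a variable in P.
  refine ⟨Finset.univ.filter fun i => (X i : MvPolynomial (Fin n) K) ∈ P, ?_, ?_⟩
  · refine Ideal.span_le.mpr ?_
    rintro _ ⟨a, ha, rfl⟩
    have haP : monomial a (1 : K) ∈ P := h (Ideal.subset_span ⟨a, ha, rfl⟩)
    rw [monomial_eq, C_1, one_mul, Finsupp.prod, Ideal.IsPrime.prod_mem_iff] at haP
    obtain ⟨i, hi, hiP⟩ := haP
    rw [SetLike.mem_coe, mem_varIdeal, support_monomial_one]
    intro c hc
    rw [Finset.mem_singleton.mp hc]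
    exact ⟨i, by simpa using Ideal.IsPrime.mem_of_pow_mem ‹_› _ hiP,
      Finsupp.mem_support_iff.mp hi⟩
  · refine Ideal.span_le.mpr ?_
    rintro _ ⟨i, hi, rfl⟩
    simpa using hi

theorem exists_eq_varIdeal_of_mem_minimalPrimes {G : Finset (Fin n)}
    {P : Ideal (MvPolynomial (Fin n) K)} (hP : P ∈ (dominanceIdeal K G).minimalPrimes) :
    ∃ A : Finset (Fin n), P = varIdeal K A := by
  have := hP.1.1
  obtain ⟨A, hA, hAP⟩ := exists_varIdeal_le hP.1.2
  exact ⟨A, le_antisymm (hP.2 ⟨inferInstance, hA⟩ hAP) hAP⟩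

variable {G : Finset (Fin n)} {a b : Fin n}

theorem StartsWith.lt_card_of_le_varIdeal (hG : StartsWith G a b) {A : Finset (Fin n)}
    (hA : dominanceIdeal K G ≤ varIdeal K A) : (a : ℕ) < A.card := by
  simpa using hG.lt_card_compl (dominanceIdeal_le_varIdeal_iff.mp hA)

theorem StartsWith.le_varIdeal_iff (hG : StartsWith G a b) {A : Finset (Fin n)}
    (hA : A.card = a + 1) : dominanceIdeal K G ≤ varIdeal K A ↔ ∀ i ∈ A, i ≤ b :=
  dominanceIdeal_le_varIdeal_iff.trans (hG.not_dominates_compl_iff hA)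

theorem StartsWith.le_varIdeal_Iic (hG : StartsWith G a b) :
    dominanceIdeal K G ≤ varIdeal K (Finset.Iic a) :=
  (hG.le_varIdeal_iff (Fin.card_Iic a)).mpr fun _ hi => (Finset.mem_Iic.mp hi).trans hG.le

theorem StartsWith.le_height_of_isPrime (hG : StartsWith G a b)
    {P : Ideal (MvPolynomial (Fin n) K)} [P.IsPrime] (hP : dominanceIdeal K G ≤ P) :
    ((a + 1 : ℕ) : ℕ∞) ≤ P.height := by
  obtain ⟨A, hA, hAP⟩ := exists_varIdeal_le hP
  refine le_trans ?_ (Ideal.height_mono hAP)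
  rw [height_varIdeal]
  exact_mod_cast hG.lt_card_of_le_varIdeal hA

theorem StartsWith.height_dominanceIdeal (hG : StartsWith G a b) :
    (dominanceIdeal K G).height = ((a + 1 : ℕ) : ℕ∞) := by
  apply le_antisymm
  · refine (Ideal.height_mono hG.le_varIdeal_Iic).trans ?_
    rw [height_varIdeal, Fin.card_Iic]
  · rw [Ideal.height_eq_inf_minimalPrimes]
    refine le_iInf₂ fun P hP => ?_
    have := hP.1.1
    exact hG.le_height_of_isPrime hP.1.2

theorem StartsWith.mem_minimalPrimes_and_height_eq_iff (hG : StartsWith G a b)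
    {P : Ideal (MvPolynomial (Fin n) K)} :
    (P ∈ (dominanceIdeal K G).minimalPrimes ∧ P.height = (dominanceIdeal K G).height) ↔
      ∃ A : Finset (Fin n), (∀ i ∈ A, i ≤ b) ∧ (A.card : ℕ∞) = (dominanceIdeal K G).height ∧
        P = varIdeal K A := by
  constructor
  · rintro ⟨hP, hht⟩
    obtain ⟨A, rfl⟩ := exists_eq_varIdeal_of_mem_minimalPrimes hP
    rw [height_varIdeal] at hht
    refine ⟨A, ?_, hht, rfl⟩
    rw [hG.height_dominanceIdeal] at hht
    exact (hG.le_varIdeal_iff (by exact_mod_cast hht)).mp hP.1.2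
  · rintro ⟨A, hA, hcard, rfl⟩
    have hht : (varIdeal K A).height = (dominanceIdeal K G).height := by
      rw [height_varIdeal, hcard]
    refine ⟨Ideal.mem_minimalPrimes_of_height_le ?_ hht.le, hht⟩
    rw [hG.height_dominanceIdeal] at hcard
    exact (hG.le_varIdeal_iff (by exact_mod_cast hcard)).mpr hA

end VarIdeal

/-! ### Krull dimension of the quotient -/

section Dimension

/-- The height of the smallest prime over `I` and the dimension of `R ⧸ I` add up to at most the
dimension of `R`. -/
theorem add_ringKrullDim_quotient_le {R : Type*} [CommRing R] {I : Ideal R} {h d : ℕ}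
    (hI : ∀ P : Ideal R, P.IsPrime → I ≤ P → (h : ℕ∞) ≤ P.height)
    (hd : ringKrullDim R ≤ (d : ℕ)) : ringKrullDim (R ⧸ I) ≤ ((d - h : ℕ) : WithBot ℕ∞) := by
  rw [ringKrullDim_quotient]
  refine iSup_le fun p => ?_
  have hhead : ((h : ℕ) : ℕ∞) ≤ Order.height (p.head : PrimeSpectrum R) := by
    rw [← PrimeSpectrum.height_eq_orderHeight]
    exact hI _ (p.head : PrimeSpectrum R).isPrime p.head.2
  -- Heights grow by at least one along the chain, starting from at least h.
  have hlast : ((h + p.length : ℕ) : ℕ∞) ≤ Order.height (p.last : PrimeSpectrum R) := by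
    have key : ∀ i : Fin (p.length + 1),
        ((h + i : ℕ) : ℕ∞) ≤ Order.height (p i : PrimeSpectrum R) := by
      refine Fin.induction (by rw [Fin.val_zero, add_zero]; exact hhead) fun i ih => ?_
      have hlt : (p i.castSucc : PrimeSpectrum R) < p i.succ := p.step i
      refine le_trans ?_ (Order.height_add_one_le hlt)
      have := add_le_add_left ih 1
      simpa [add_assoc] using this
    exact key (Fin.last _)
  have : ((h + p.length : ℕ) : WithBot ℕ∞) ≤ (d : ℕ) :=
    le_trans (by exact_mod_cast hlast) ((Order.height_le_krullDim _).trans hd)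
  have : h + p.length ≤ d := by exact_mod_cast this
  exact_mod_cast (by omega : p.length ≤ d - h)

/-- The height gives the upper bound. For the lower one, killing the variables up to a maps the
quotient onto a polynomial ring in n - (a + 1) variables. -/
theorem StartsWith.ringKrullDim_quotient_dominanceIdeal {n : ℕ} {K : Type*} [Field K]
    {G : Finset (Fin n)} {a b : Fin n} (hG : StartsWith G a b) :
    ringKrullDim (MvPolynomial (Fin n) K ⧸ dominanceIdeal K G) =
      ((n - (a + 1) : ℕ) : WithBot ℕ∞) := by
  apply le_antisymm
  · refine add_ringKrullDim_quotient_le (fun P _ hP => hG.le_height_of_isPrime hP) ?_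
    rw [MvPolynomial.ringKrullDim_of_isNoetherianRing]
    simp
  · let f : MvPolynomial (Fin n) K →+* MvPolynomial {i : Fin n // a < i} K :=
      (killCompl (R := K) (Subtype.val_injective (p := fun i : Fin n => a < i))).toRingHom
    have hker : ∀ p ∈ dominanceIdeal K G, f p = 0 := by
      suffices dominanceIdeal K G ≤ RingHom.ker f from fun p hp => this hp
      refine hG.le_varIdeal_Iic.trans (Ideal.span_le.mpr ?_)
      rintro _ ⟨i, hi, rfl⟩
      have hia : i ≤ a := by simpa using hi
      simp [f, killCompl, RingHom.mem_ker, hia]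
    have hsurj : Function.Surjective f := fun p =>
      ⟨_, killCompl_rename_app (Subtype.val_injective (p := fun i : Fin n => a < i)) p⟩
    have := ringKrullDim_le_of_surjective (Ideal.Quotient.lift _ f hker)
      (Ideal.Quotient.lift_surjective_of_surjective _ _ hsurj)
    rw [MvPolynomial.ringKrullDim_of_isNoetherianRing, ringKrullDim_eq_zero_of_field,
      zero_add, Nat.card_eq_fintype_card, Fintype.card_subtype] at this
    refine le_trans (le_of_eq ?_) this
    have hcard : (Finset.univ.filter fun i : Fin n => a < i) = Finset.Ioi a := by
      ext; simp
    rw [hcard, Fin.card_Ioi, Nat.sub_sub, add_comm 1]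

end Dimension

/-! ### Hilbert series and multiplicity -/

section Hilbert

variable {n : ℕ} {K : Type*} [Field K] {G : Finset (Fin n)}

theorem mem_finsuppAntidiag_univ {a : Fin n →₀ ℕ} {d : ℕ} :
    a ∈ Finset.finsuppAntidiag Finset.univ d ↔ a.degree = d := by
  rw [Finset.mem_finsuppAntidiag, Finsupp.degree_eq_sum]
  simp

/-- The Hilbert function of the quotient by a dominance ideal counts the monomials outside it. -/
theorem hilbertFunction_dominanceIdeal (d : ℕ) :
    hilbertFunction (dominanceIdeal K G) d =
      {a : Fin n →₀ ℕ | a.degree = d ∧ ¬ Dominates G a.support}.ncard := by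
  set I := dominanceIdeal K G with hI
  set s : Set (Fin n →₀ ℕ) := {a | a.degree = d ∧ ¬ Dominates G a.support} with hs
  let v : s → MvPolynomial (Fin n) K ⧸ I := fun a => Ideal.Quotient.mkₐ K I (monomial a.1 1)
  have hspan : (homogeneousSubmodule (Fin n) K d).map (Ideal.Quotient.mkₐ K I).toLinearMap =
      Submodule.span K (Set.range v) := by
    apply le_antisymm
    · rintro _ ⟨p, hp, rfl⟩
      rw [p.as_sum, map_sum]
      refine Submodule.sum_mem _ fun a ha => ?_
      have hdeg : a.degree = d := by
        by_contra hne
        exact mem_support_iff.mp ha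
          (((mem_homogeneousSubmodule d p).mp hp).coeff_eq_zero hne)
      rw [← mul_one (coeff a p), ← smul_eq_mul, ← smul_monomial, map_smul]
      refine Submodule.smul_mem _ _ ?_
      by_cases hdom : Dominates G a.support
      · have : (Ideal.Quotient.mkₐ K I).toLinearMap (monomial a 1) = 0 :=
          Ideal.Quotient.eq_zero_iff_mem.mpr (monomial_mem_dominanceIdeal.mpr hdom)
        rw [this]
        exact Submodule.zero_mem _
      · exact Submodule.subset_span ⟨⟨a, hdeg, hdom⟩, rfl⟩
    · refine Submodule.span_le.mpr ?_
      rintro _ ⟨a, rfl⟩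
      exact ⟨monomial a.1 1, isHomogeneous_monomial 1 a.2.1, rfl⟩
  have hli : LinearIndependent K v := by
    rw [linearIndependent_iff']
    intro t g hg a ha
    have hmem : ∑ c ∈ t, g c • (monomial c.1 (1 : K)) ∈ I := by
      rw [← Ideal.Quotient.eq_zero_iff_mem, ← Ideal.Quotient.mkₐ_eq_mk K, ← hg, map_sum]
      exact Finset.sum_congr rfl fun c _ => map_smul _ _ _
    have hcoeff : coeff a.1 (∑ c ∈ t, g c • (monomial c.1 (1 : K))) = g a := by
      classical
      rw [coeff_sum, Finset.sum_eq_single a]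
      · simp
      · intro c _ hca
        simp [coeff_monomial, Subtype.coe_injective.ne hca]
      · exact fun h => absurd ha h
    by_contra hga
    exact a.2.2 (mem_dominanceIdeal.mp hmem a.1 (mem_support_iff.mpr (hcoeff ▸ hga)))
  have : Finite s := (Finset.finsuppAntidiag Finset.univ d).finite_toSet.subset fun a ha =>
    mem_finsuppAntidiag_univ.mpr ha.1
  have := Fintype.ofFinite s
  rw [hilbertFunction, hspan, ← Nat.card_coe_set_eq, Nat.card_eq_fintype_card]
  exact finrank_span_eq_card hli

/-- The generating function of the monomials with support exactly `F`. -/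
theorem mk_card_support_eq_mul_pow (F : Finset (Fin n)) :
    (PowerSeries.mk fun d => (((Finset.finsuppAntidiag Finset.univ d).filter
      fun a : Fin n →₀ ℕ => a.support = F).card : ℤ)) * (1 - PowerSeries.X) ^ F.card =
      PowerSeries.X ^ F.card := by
  have hgeom : (PowerSeries.X * PowerSeries.mk 1 : PowerSeries ℤ) * (1 - PowerSeries.X) =
      PowerSeries.X := by
    rw [mul_assoc, PowerSeries.mk_one_mul_one_sub_eq_one, mul_one]
  have hprod : (PowerSeries.mk fun d => (((Finset.finsuppAntidiag Finset.univ d).filter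
      fun a : Fin n →₀ ℕ => a.support = F).card : ℤ)) =
      -- Each i in F contributes t + t² + ⋯ = t / (1 - t), for its positive exponent.
      ∏ _i ∈ F, (PowerSeries.X * PowerSeries.mk 1 : PowerSeries ℤ) := by
    ext d
    rw [PowerSeries.coeff_mk, PowerSeries.coeff_prod]
    have hc : ∀ m : ℕ, PowerSeries.coeff m (PowerSeries.X * PowerSeries.mk 1 : PowerSeries ℤ) =
        if m ≠ 0 then 1 else 0 := by
      rintro (_ | m)
      · simp
      · simp [PowerSeries.coeff_succ_X_mul]
    simp only [hc, Finset.prod_ite_zero, Finset.prod_const_one]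
    rw [Finset.sum_boole]
    congr 2
    ext a
    simp only [Finset.mem_filter, mem_finsuppAntidiag_univ]
    rw [Finset.mem_finsuppAntidiag]
    constructor
    · rintro ⟨hd, rfl⟩
      exact ⟨⟨hd, subset_rfl⟩, fun i hi => Finsupp.mem_support_iff.mp hi⟩
    · rintro ⟨⟨hd, hsub⟩, hF⟩
      have hsupp : a.support = F :=
        hsub.antisymm fun i hi => Finsupp.mem_support_iff.mpr (hF i hi)
      refine ⟨?_, hsupp⟩
      rw [← hd, ← hsupp]
      rfl
  rw [hprod, Finset.prod_const, ← mul_pow, hgeom]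

open Classical in
/-- The numerator of the Hilbert series with respect to the denominator `(1 - t) ^ d`, as a sum
over the faces of the simplicial complex. -/
noncomputable def faceNumerator (G : Finset (Fin n)) (d : ℕ) : Polynomial ℤ :=
  ∑ F : Finset (Fin n) with ¬ Dominates G F, Polynomial.X ^ F.card *
    (1 - Polynomial.X) ^ (d - F.card)

theorem hilbertSeries_dominanceIdeal_mul {d : ℕ}
    (hd : ∀ F : Finset (Fin n), ¬ Dominates G F → F.card ≤ d) :
    hilbertSeries (dominanceIdeal K G) * (1 - PowerSeries.X) ^ d =
      (faceNumerator G d : PowerSeries ℤ) := by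
  classical
  have hseries : hilbertSeries (dominanceIdeal K G) =
      ∑ F : Finset (Fin n) with ¬ Dominates G F,
        PowerSeries.mk fun d => (((Finset.finsuppAntidiag Finset.univ d).filter
          fun a : Fin n →₀ ℕ => a.support = F).card : ℤ) := by
    ext m
    rw [hilbertSeries, PowerSeries.coeff_mk, hilbertFunction_dominanceIdeal, map_sum]
    simp only [PowerSeries.coeff_mk]
    have hset : {a : Fin n →₀ ℕ | a.degree = m ∧ ¬ Dominates G a.support} =
        (((Finset.finsuppAntidiag Finset.univ m).filter
          fun a : Fin n →₀ ℕ => ¬ Dominates G a.support : Finset _) : Set (Fin n →₀ ℕ)) := by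
      ext a
      rw [Finset.mem_coe, Finset.mem_filter, mem_finsuppAntidiag_univ, Set.mem_ofPred_eq]
    rw [hset, Set.ncard_coe_finset, ← Nat.cast_sum,
      Finset.card_eq_sum_card_fiberwise (f := Finsupp.support)
        (t := Finset.univ.filter fun F : Finset (Fin n) => ¬ Dominates G F)
        (fun a ha => by simpa using (Finset.mem_filter.mp ha).2)]
    refine congrArg _ (Finset.sum_congr rfl fun F hF => ?_)
    rw [Finset.filter_filter]
    refine congrArg _ (Finset.filter_congr fun a _ => ?_)
    exact ⟨And.right, fun h => ⟨h ▸ (Finset.mem_filter.mp hF).2, h⟩⟩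
  rw [hseries, Finset.sum_mul, faceNumerator, ← Polynomial.coeToPowerSeries.ringHom_apply,
    map_sum]
  refine Finset.sum_congr rfl fun F hF => ?_
  have hFd := hd F (Finset.mem_filter.mp hF).2
  rw [← Nat.add_sub_cancel' hFd, pow_add, ← mul_assoc, mk_card_support_eq_mul_pow]
  simp

/-- At t = 1 the factor (1 - t)^(d - |F|) kills every face with fewer than d elements. -/
theorem eval_one_faceNumerator {d : ℕ}
    (hd : ∀ F : Finset (Fin n), ¬ Dominates G F → F.card ≤ d) :
    (faceNumerator G d).eval 1 =
      {F : Finset (Fin n) | ¬ Dominates G F ∧ F.card = d}.ncard := by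
  classical
  have hset : {F : Finset (Fin n) | ¬ Dominates G F ∧ F.card = d} =
      (((Finset.univ.filter fun F : Finset (Fin n) => ¬ Dominates G F).filter
        fun F => F.card = d : Finset (Finset (Fin n))) : Set (Finset (Fin n))) := by
    ext; simp
  rw [hset, Set.ncard_coe_finset, Finset.card_filter, Nat.cast_sum, faceNumerator,
    Polynomial.eval_finsetSum]
  refine Finset.sum_congr (by congr) fun F hF => ?_
  have hFd := hd F (Finset.mem_filter.mp hF).2
  rcases hFd.eq_or_lt with h | h
  · simp [h]
  · simp [h.ne, zero_pow (Nat.sub_pos_of_lt h).ne']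

theorem StartsWith.ncard_facets {a b : Fin n} (hG : StartsWith G a b) :
    {F : Finset (Fin n) | ¬ Dominates G F ∧ F.card = n - (a + 1)}.ncard =
      (b + 1 : ℕ).choose (a + 1) := by
  have hset : {F : Finset (Fin n) | ¬ Dominates G F ∧ F.card = n - (a + 1)} =
      (fun A => Aᶜ) '' ((Finset.powersetCard (a + 1) (Finset.Iic b) : Finset (Finset (Fin n))) :
        Set (Finset (Fin n))) := by
    ext F
    simp only [Set.mem_ofPred_eq, Set.mem_image, Finset.mem_coe, Finset.mem_powersetCard]
    constructor
    · rintro ⟨hF, hcard⟩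
      have hc : Fᶜ.card = a + 1 := by
        rw [Finset.card_compl, Fintype.card_fin, hcard]
        omega
      rw [← compl_compl F] at hF
      exact ⟨Fᶜ, ⟨fun i hi => Finset.mem_Iic.mpr ((hG.not_dominates_compl_iff hc).mp hF i hi),
        hc⟩, compl_compl F⟩
    · rintro ⟨A, ⟨hA, hc⟩, rfl⟩
      refine ⟨(hG.not_dominates_compl_iff hc).mpr fun i hi => Finset.mem_Iic.mp (hA hi), ?_⟩
      rw [Finset.card_compl, Fintype.card_fin, hc]
  rw [hset, Set.ncard_image_of_injective _ compl_injective, Set.ncard_coe_finset,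
    Finset.card_powersetCard, Fin.card_Iic]

theorem StartsWith.hasMultiplicity (hG : StartsWith G a b) :
    HasMultiplicity (dominanceIdeal K G) ((b + 1 : ℕ).choose (a + 1) : ℕ) := by
  have hd : ∀ F : Finset (Fin n), ¬ Dominates G F → F.card ≤ n - (a + 1) := fun F hF => by
    have h₁ := hG.lt_card_compl hF
    have h₂ := F.card_add_card_compl
    rw [Fintype.card_fin] at h₂
    omega
  exact ⟨n - (a + 1), faceNumerator G _, hG.ringKrullDim_quotient_dominanceIdeal,
    hilbertSeries_dominanceIdeal_mul hd, by rw [eval_one_faceNumerator hd, hG.ncard_facets]⟩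

theorem maxIndex_Icc {a b : Fin n} (hab : a ≤ b) : maxIndex (Finset.Icc a b) = b + 1 := by
  apply le_antisymm
  · refine Finset.sup_le fun i hi => ?_
    have : (i : ℕ) ≤ b := (Finset.mem_Icc.mp hi).2
    omega
  · exact Finset.le_sup (f := fun i : Fin n => (i : ℕ) + 1) (Finset.mem_Icc.mpr ⟨hab, le_rfl⟩)

end Hilbert

end SqfreeBorel

theorem theorem3p1 {n : ℕ} {K : Type*} [Field K]
    (I : Ideal (MvPolynomial (Fin n) K)) (u : Fin n →₀ ℕ) (B₁ : Finset (Fin n))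
    (hI : SqfreeBorel.IsSqfreePrincipalBorel I u)
    (hB₁ : SqfreeBorel.IsFirstBlock u B₁) :
    (∀ P : Ideal (MvPolynomial (Fin n) K),
      (P ∈ I.minimalPrimes ∧ P.height = I.height) ↔
        ∃ A : Finset (Fin n), (∀ i ∈ A, (i : ℕ) + 1 ≤ SqfreeBorel.maxIndex B₁) ∧
          (A.card : ℕ∞) = I.height ∧ P = SqfreeBorel.varIdeal K A) ∧
    SqfreeBorel.HasMultiplicity I
      (((SqfreeBorel.maxIndex B₁).choose (B₁.card - 1) : ℕ) : ℤ) := by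
  obtain ⟨hu, rfl⟩ := hI
  obtain ⟨a, b, rfl, hG⟩ := hB₁.exists_startsWith
  rw [SqfreeBorel.borelIdeal_singleton hu, SqfreeBorel.maxIndex_Icc hG.le]
  constructor
  · intro P
    simpa only [Nat.add_le_add_iff_right, Fin.le_def] using hG.mem_minimalPrimes_and_height_eq_iff
  · have hab : (a : ℕ) ≤ b := hG.le
    -- The facet count chooses a + 1 elements, the stated formula the remaining b - a.
    have hsymm : (b + 1 : ℕ).choose ((Finset.Icc a b).card - 1) =
        (b + 1 : ℕ).choose (a + 1) := by
      rw [Fin.card_Icc, ← Nat.choose_symm (show (a : ℕ) + 1 ≤ b + 1 by omega)]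
      congr 1
    rw [hsymm]
    exact hG.hasMultiplicity
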